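/- Let $n,N\ge 1$ and let $\Omega\subset\mathbb{R}^n$ be a bounded Lipschitz domain. Let $\mathbb{A}=(\mathbb{A}^{\alpha\beta}_{ij})\in L^\infty(\Omega;\mathbb{R}^{(N\times n)\times(N\times n)})$ have the form $$\mathbb{A}^{\alpha\beta}_{ij}(x)=\mathcal{A}^{\alpha\beta}\,a_{ij}(x)\qquad\text{for a.e. }x\in\Omega,\quad \alpha,\beta=1,\dots,N,\ i,j=1,\dots,n,$$ where $\mathcal{A}\in\mathbb{R}^{N\times N}$ is a constant symmetric positive definite matrix and $a=(a_{ij})\in L^\infty(\Omega;\mathbb{R}^{n\times n})$ is symmetric and uniformly positive definite, i.e. there is $\lambda>0$ such that for a.e. $x\in\Omega$ one has $\xi\cdot a(x)\xi\ge\lambda|\xi|^2$ for all $\xi\in\mathbb{R}^n$. Let $u\in W^{1,2}(\Omega;\mathbb{R}^N)$ be a weak solution of $-\operatorname{div}(\mathbb{A}\nabla u)=0$ in $\Omega$, that is, $$\int_\Omega\sum_{\alpha,\beta=1}^N\sum_{i,j=1}^n\mathbb{A}^{\alpha\beta}_{ij}(x)\,\frac{\partial u^\beta}{\partial x_j}(x)\,\frac{\partial\varphi^\alpha}{\partial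 x_i}(x)\,dx=0$$ for all $\varphi\in W^{1,2}_0(\Omega;\mathbb{R}^N)$, the space of functions in $W^{1,2}(\Omega;\mathbb{R}^N)$ with zero trace on $\partial\Omega$. Let $$\overline{\operatorname{conv}}\,u(\partial\Omega)=\bigcap\bigl\{K\subset\mathbb{R}^N:\ K\text{ closed and convex},\ (\operatorname{tr}u)(x)\in K\text{ for a.e. }x\in\partial\Omega\bigr\},$$ where $\operatorname{tr}u\in L^2(\partial\Omega;\mathbb{R}^N)$ is the trace of $u$ and "a.e." on $\partial\Omega$ refers to the surface measure. Then $$u(x)\in\overline{\operatorname{conv}}\,u(\partial\Omega)\qquad\text{for a.e. }x\in\Omega.$$ -/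

import Mathlib

open MeasureTheory Filter Topology
open scoped ContDiff

noncomputable section

/-- Euclidean space `ℝᵈ`. -/
abbrev Euc (d : ℕ) : Type := EuclideanSpace ℝ (Fin d)

/-- The classical partial derivative `∂f/∂xᵢ` at `x` of a (scalar or vector valued) function. -/
def partialDeriv {n : ℕ} {F : Type*} [NormedAddCommGroup F] [NormedSpace ℝ F]
    (i : Fin n) (f : Euc n → F) (x : Euc n) : F :=
  fderiv ℝ f x (EuclideanSpace.single i 1)

/-- Bounded Lipschitz domains: bounded open sets such that, near each boundary point, the set is
the strict epigraph, in some direction `e`, of a Lipschitz function on the hyperplane `e⊥`.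
Connectedness is not required, so that both usual conventions for "domain" are covered. -/
structure IsBoundedLipschitzDomain {n : ℕ} (Ω : Set (Euc n)) : Prop where
  isOpen : IsOpen Ω
  isBounded : Bornology.IsBounded Ω
  locallyEpigraph : ∀ x₀ ∈ frontier Ω, ∃ e : Euc n, ‖e‖ = 1 ∧
    ∃ (L : NNReal) (γ : (Submodule.span ℝ {e})ᗮ → ℝ), LipschitzWith L γ ∧
    ∃ U : Set (Euc n), IsOpen U ∧ x₀ ∈ U ∧
      Ω ∩ U = {x ∈ U | γ ((Submodule.span ℝ {e})ᗮ.orthogonalProjectionOnto x) < inner ℝ e x}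

/-- The surface measure on `∂Ω`: the `(n-1)`-dimensional Hausdorff measure restricted to `∂Ω`. -/
def surfaceMeasure {n : ℕ} (Ω : Set (Euc n)) : Measure (Euc n) :=
  (Measure.hausdorffMeasure ((n : ℝ) - 1)).restrict (frontier Ω)

/-- `u ∈ W^{1,2}(Ω; ℝᴺ)` with weak gradient `G`, where `G x α i` is `∂u^α/∂xᵢ` at `x`. -/
structure HasSobolevGradient {n N : ℕ} (Ω : Set (Euc n)) (u : Euc n → Euc N)
    (G : Euc n → Matrix (Fin N) (Fin n) ℝ) : Prop where
  memLp : MemLp u 2 (volume.restrict Ω)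
  memLp_grad : ∀ α i, MemLp (fun x => G x α i) 2 (volume.restrict Ω)
  integral_by_parts : ∀ φ : Euc n → ℝ, ContDiff ℝ ∞ φ → HasCompactSupport φ → tsupport φ ⊆ Ω →
    ∀ α i, ∫ x in Ω, u x α * partialDeriv i φ x = -∫ x in Ω, G x α i * φ x

/-- `g` is the trace on `∂Ω` of `u ∈ W^{1,2}(Ω; ℝᴺ)`: the pair `(u, g)` is a limit, in
`W^{1,2}(Ω) × L²(∂Ω)`, of pairs `(φₖ, φₖ|∂Ω)` with `φₖ` smooth on `ℝⁿ`. On a bounded Lipschitz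
domain smooth functions are dense in `W^{1,2}(Ω)`, and this is the graph of the trace operator,
the continuous extension of the restriction map `φ ↦ φ|∂Ω`. -/
def HasTrace {n N : ℕ} (Ω : Set (Euc n)) (u g : Euc n → Euc N) : Prop :=
  MemLp g 2 (surfaceMeasure Ω) ∧
  ∃ G : Euc n → Matrix (Fin N) (Fin n) ℝ, HasSobolevGradient Ω u G ∧
  ∃ φ : ℕ → Euc n → Euc N, (∀ k, ContDiff ℝ ∞ (φ k)) ∧
    Tendsto (fun k => eLpNorm (fun x => φ k x - u x) 2 (volume.restrict Ω)) atTop (𝓝 0) ∧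
    (∀ α i, Tendsto
      (fun k => eLpNorm (fun x => partialDeriv i (φ k) x α - G x α i) 2 (volume.restrict Ω))
      atTop (𝓝 0)) ∧
    Tendsto (fun k => eLpNorm (fun x => φ k x - g x) 2 (surfaceMeasure Ω)) atTop (𝓝 0)

/-- `u ∈ W₀^{1,2}(Ω; ℝᴺ)`: the Sobolev functions with zero trace. -/
def MemW0 {n N : ℕ} (Ω : Set (Euc n)) (u : Euc n → Euc N) : Prop := HasTrace Ω u 0

/-- Weak solutions `u ∈ W^{1,2}(Ω; ℝᴺ)` of `-div (𝔸 ∇u) = 0` in `Ω`. The coefficient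
`𝔸 x α β i j` couples `∂u^β/∂xⱼ` with `∂φ^α/∂xᵢ`. -/
def IsWeakSolution {n N : ℕ} (Ω : Set (Euc n))
    (𝔸 : Euc n → Fin N → Fin N → Fin n → Fin n → ℝ) (u : Euc n → Euc N) : Prop :=
  ∃ G : Euc n → Matrix (Fin N) (Fin n) ℝ, HasSobolevGradient Ω u G ∧
    ∀ (φ : Euc n → Euc N) (H : Euc n → Matrix (Fin N) (Fin n) ℝ),
      MemW0 Ω φ → HasSobolevGradient Ω φ H →
      ∫ x in Ω, ∑ α, ∑ β, ∑ i, ∑ j, 𝔸 x α β i j * G x β j * H x α i = 0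

/-- The closed convex hull of the boundary values of `u ∈ W^{1,2}(Ω; ℝᴺ)`: the intersection of all
closed convex sets that contain the trace of `u` at almost every point of `∂Ω`. -/
def boundaryHull {n N : ℕ} (Ω : Set (Euc n)) (u : Euc n → Euc N) : Set (Euc N) :=
  ⋂₀ {K | IsClosed K ∧ Convex ℝ K ∧
    ∃ g : Euc n → Euc N, HasTrace Ω u g ∧ ∀ᵐ x ∂(surfaceMeasure Ω), g x ∈ K}

end

/-!
The complement of a closed convex set is a union of open half-spaces, and by the Lindelöf property
countably many half-spaces suffice to cover the complement of the hull. So it is enough to show: if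
the trace of `u` satisfies `⟪ν, ·⟫ ≤ c` almost everywhere on `∂Ω`, then `⟪ν, u⟫ ≤ c` almost
everywhere in `Ω` (`IsWeakSolution.ae_inner_le`).

Choose `b` with `b 𝒜 = ν`. Because the coefficients are the product `𝒜 ⊗ a`, testing the system with
a scalar function times `b` yields the scalar equation `-div (a ∇v) = 0` for `v = ⟪ν, u⟫ - c`
(`sum_coeff_mul_eq`). The scalar factor is `f ∘ v`, where `f = smoothPosPart` is smooth, `1`-Lipschitz,
zero on `(-∞, 0]` and strictly increasing afterwards. It is admissible: if smooth `φₖ` realize the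
trace of `u`, then, along a subsequence, the smooth functions `f (⟪ν, φₖ⟫ - c)` tend to `f ∘ v` in
`W^{1,2}(Ω)` and to zero in `L²(∂Ω)` (`HasTrace.exists_seq_smoothPosPart`). The resulting identity
`∫ f'(v) a ∇v · ∇v = 0` and ellipticity give `f'(v) ∇v = 0`
(`IsWeakSolution.smoothTransition_mul_grad_eq_zero`).

Thus `f ∘ v` has zero trace and zero gradient, and it has to vanish. This is seen on lines parallel
to a coordinate axis (`exists_seq_ae_tendsto_zero_of_boundary`): each point of `Ω` is joined inside
`Ω` to a boundary point on its line, and for almost every line the approximating functions tend to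
zero at all boundary points on it, since a subset of `∂Ω` of zero `(n-1)`-dimensional Hausdorff
measure has a null projection. Their derivatives tend to zero in `L¹` along almost every line, so
the functions themselves tend to zero. Finally `f (v) = 0` means `v ≤ 0`.
-/

/-! ### Functions on the line -/

/-- A point of an open subset of the line that is bounded below is reached, within the set, from a
boundary point on its left. -/
theorem exists_left_exit {S : Set ℝ} (hS : IsOpen S) (hb : BddBelow S) {t : ℝ} (ht : t ∈ S) :
    ∃ a ≤ t, a ∈ frontier S ∧ Set.Ioc a t ⊆ S := by
  obtain ⟨m, hm⟩ := hb
  -- The exit point is the last point to the left of `t` outside `S`.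
  set T : Set ℝ := {r | r ≤ t ∧ r ∉ S} with hT
  have hTc : IsClosed T := isClosed_Iic.inter hS.isClosed_compl
  have hTn : T.Nonempty := by
    refine ⟨m - 1, ?_, fun h => ?_⟩
    · linarith [hm ht]
    · linarith [hm h]
  have hTb : BddAbove T := ⟨t, fun r hr => hr.1⟩
  have haT : sSup T ∈ T := hTc.csSup_mem hTn hTb
  have hIoc : Set.Ioc (sSup T) t ⊆ S := by
    intro r hr
    by_contra hrS
    exact absurd (le_csSup hTb (show r ∈ T from ⟨hr.2, hrS⟩)) (not_le.mpr hr.1)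
  have hlt : sSup T < t := lt_of_le_of_ne haT.1 (fun h => haT.2 (h ▸ ht))
  refine ⟨sSup T, haT.1, ?_, hIoc⟩
  rw [hS.frontier_eq]
  refine ⟨closure_mono hIoc ?_, haT.2⟩
  rw [closure_Ioc hlt.ne]
  exact ⟨le_rfl, hlt.le⟩

theorem enorm_le_enorm_add_lintegral_deriv {ψ ψ' : ℝ → ℝ} (h : ∀ t, HasDerivAt ψ (ψ' t) t)
    (hc : Continuous ψ') {a t : ℝ} (hat : a ≤ t) {S : Set ℝ} (hS : Set.Ioc a t ⊆ S) :
    ‖ψ t‖ₑ ≤ ‖ψ a‖ₑ + ∫⁻ r in S, ‖ψ' r‖ₑ := by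
  have h1 : ∫ r in a..t, ψ' r = ψ t - ψ a :=
    intervalIntegral.integral_eq_sub_of_hasDerivAt (fun x _ => h x) (hc.intervalIntegrable _ _)
  have h2 : ψ t = ψ a + ∫ r in Set.Ioc a t, ψ' r := by
    rw [← intervalIntegral.integral_of_le hat, h1]; ring
  rw [h2]
  refine (enorm_add_le _ _).trans ?_
  gcongr
  exact (enorm_integral_le_lintegral_enorm _).trans (lintegral_mono_set hS)

/-! ### Splitting off a coordinate of Euclidean space -/

/-- The splitting `x ↦ ((x₁, …, x_m), x₀)` of Euclidean space into a hyperplane and a line. -/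
noncomputable def splitCoord (m : ℕ) : Euc (m + 1) ≃ᵐ (Fin m → ℝ) × ℝ :=
  ((MeasurableEquiv.toLp 2 (Fin (m + 1) → ℝ)).symm.trans
    (MeasurableEquiv.piFinSuccAbove (fun _ => ℝ) 0)).trans MeasurableEquiv.prodComm

theorem measurePreserving_splitCoord (m : ℕ) : MeasurePreserving (splitCoord m) :=
  (Measure.measurePreserving_swap (μ := (volume : Measure ℝ))
    (ν := (volume : Measure (Fin m → ℝ)))).comp
    ((volume_preserving_piFinSuccAbove (fun _ : Fin (m + 1) => ℝ) 0).comp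
      (EuclideanSpace.volume_preserving_symm_measurableEquiv_toLp (Fin (m + 1))))

theorem splitCoord_apply_fst {m : ℕ} (x : Euc (m + 1)) :
    (splitCoord m x).1 = fun i : Fin m => x i.succ := rfl

theorem splitCoord_symm_eq {m : ℕ} (y : Fin m → ℝ) (t : ℝ) :
    (splitCoord m).symm (y, t) =
      (splitCoord m).symm (y, 0) + t • EuclideanSpace.single (0 : Fin (m + 1)) (1 : ℝ) := by
  have h : ∀ t : ℝ, (splitCoord m).symm (y, t) = WithLp.toLp 2 (Fin.cons t y) := by
    intro t
    rw [MeasurableEquiv.symm_apply_eq]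
    rfl
  rw [h, h]
  ext i
  refine Fin.cases ?_ (fun j => ?_) i <;> simp

theorem hasDerivAt_comp_splitCoord_symm {m : ℕ} {φ : Euc (m + 1) → ℝ} (hφ : ContDiff ℝ 1 φ)
    (y : Fin m → ℝ) (t : ℝ) :
    HasDerivAt (fun t => φ ((splitCoord m).symm (y, t)))
      (partialDeriv 0 φ ((splitCoord m).symm (y, t))) t := by
  have h1 : HasDerivAt (fun t => (splitCoord m).symm (y, t))
      (EuclideanSpace.single (0 : Fin (m + 1)) (1 : ℝ)) t := by
    have : (fun t => (splitCoord m).symm (y, t)) = fun t => (splitCoord m).symm (y, 0) +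
        t • EuclideanSpace.single (0 : Fin (m + 1)) (1 : ℝ) := funext (splitCoord_symm_eq y)
    rw [this]
    simpa using ((hasDerivAt_id t).smul_const
      (EuclideanSpace.single (0 : Fin (m + 1)) (1 : ℝ))).const_add ((splitCoord m).symm (y, 0))
  exact ((hφ.differentiable (by simp)) _).hasFDerivAt.comp_hasDerivAt t h1

theorem continuous_splitCoord_symm_line {m : ℕ} (y : Fin m → ℝ) :
    Continuous fun t : ℝ => (splitCoord m).symm (y, t) := by
  have : (fun t => (splitCoord m).symm (y, t)) = fun t => (splitCoord m).symm (y, 0) +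
      t • EuclideanSpace.single (0 : Fin (m + 1)) (1 : ℝ) := funext (splitCoord_symm_eq y)
  rw [this]
  fun_prop

theorem continuous_partialDeriv {n : ℕ} {F : Type*} [NormedAddCommGroup F] [NormedSpace ℝ F]
    {φ : Euc n → F} (hφ : ContDiff ℝ 1 φ) (i : Fin n) : Continuous (partialDeriv i φ) :=
  (hφ.continuous_fderiv (by simp)).clm_apply continuous_const

/-- Orthogonal projection onto the hyperplane does not increase the `m`-dimensional Hausdorff
measure, so lines through a negligible part of `∂Ω` form a negligible family. -/
theorem ae_line_of_ae_surfaceMeasure {m : ℕ} {Ω : Set (Euc (m + 1))} {p : Euc (m + 1) → Prop}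
    (h : ∀ᵐ x ∂(surfaceMeasure Ω), p x) :
    ∀ᵐ y : Fin m → ℝ, ∀ t : ℝ, (splitCoord m).symm (y, t) ∈ frontier Ω →
      p ((splitCoord m).symm (y, t)) := by
  rw [surfaceMeasure, ae_restrict_iff' isClosed_frontier.measurableSet, ae_iff] at h
  -- Negligible points of the boundary, projected by dropping the coordinate `x₀`. The target carries
  -- the sup norm, for which Hausdorff measure is Lebesgue measure.
  set Z := {x | ¬(x ∈ frontier Ω → p x)}
  have hlip : LipschitzWith 1 (fun x : Euc (m + 1) => (splitCoord m x).1) := by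
    refine LipschitzWith.of_dist_le_mul fun x y => ?_
    rw [NNReal.coe_one, one_mul, dist_pi_le_iff dist_nonneg]
    intro i
    rw [splitCoord_apply_fst, splitCoord_apply_fst, dist_eq_norm, dist_eq_norm]
    exact PiLp.norm_apply_le (x - y) i.succ
  have hd : ((m + 1 : ℕ) : ℝ) - 1 = m := by push_cast; ring
  rw [hd] at h
  have h2 := hlip.hausdorffMeasure_image_le (Nat.cast_nonneg m) Z
  rw [h, mul_zero, nonpos_iff_eq_zero] at h2
  have h3 : (Measure.hausdorffMeasure (m : ℝ) : Measure (Fin m → ℝ)) = volume := by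
    simpa using hausdorffMeasure_pi_real (ι := Fin m)
  rw [h3] at h2
  rw [ae_iff]
  refine measure_mono_null ?_ h2
  intro y hy
  simp only [Set.mem_ofPred_eq, not_forall] at hy
  obtain ⟨t, ht, hp⟩ := hy
  exact ⟨(splitCoord m).symm (y, t), by simp [Z, ht, hp], by simp⟩

/-! ### Vanishing of functions with zero trace and zero gradient -/

theorem exists_seq_ae_tendsto_zero_of_lintegral {α : Type*} [MeasurableSpace α] {μ : Measure α}
    {F : ℕ → α → ENNReal} (hF : ∀ k, AEMeasurable (F k) μ)
    (h : Tendsto (fun k => ∫⁻ x, F k x ∂μ) atTop (𝓝 0)) :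
    ∃ ns : ℕ → ℕ, StrictMono ns ∧ ∀ᵐ x ∂μ, Tendsto (fun k => F (ns k) x) atTop (𝓝 0) := by
  obtain ⟨ns, hns, hle⟩ : ∃ ns : ℕ → ℕ, StrictMono ns ∧
      ∀ k, ∫⁻ x, F (ns k) x ∂μ ≤ (2⁻¹ : ENNReal) ^ k :=
    extraction_forall_of_eventually fun k =>
      h.eventually_le_const (ENNReal.pow_pos (by simp) k)
  refine ⟨ns, hns, ?_⟩
  have hsum : ∫⁻ x, ∑' k, F (ns k) x ∂μ ≠ ⊤ := by
    rw [lintegral_tsum fun k => hF _]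
    refine ne_top_of_le_ne_top ?_ (ENNReal.tsum_le_tsum hle)
    rw [ENNReal.tsum_geometric]
    simp
  filter_upwards [ae_lt_top' (AEMeasurable.tsum fun k => hF _) hsum] with x hx
  exact ENNReal.tendsto_atTop_zero_of_tsum_ne_top hx.ne

theorem exists_seq_ae_tendsto_of_eLpNorm {α E : Type*} [MeasurableSpace α] {μ : Measure α}
    [NormedAddCommGroup E] {f : ℕ → α → E} {g : α → E}
    (hf : ∀ k, AEStronglyMeasurable (f k) μ) (hg : AEStronglyMeasurable g μ)
    (h : Tendsto (fun k => eLpNorm (fun x => f k x - g x) 2 μ) atTop (𝓝 0)) :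
    ∃ ns : ℕ → ℕ, StrictMono ns ∧ ∀ᵐ x ∂μ, Tendsto (fun k => f (ns k) x) atTop (𝓝 (g x)) :=
  (tendstoInMeasure_of_tendsto_eLpNorm (by norm_num) hf hg h).exists_seq_tendsto_ae

/-- If smooth functions tend to zero in `L²(∂Ω)` and so do their derivatives in one direction in
`L²(Ω)`, a subsequence tends to zero almost everywhere in `Ω`. On almost every line in that
direction the function is controlled by its value at an exit point and the integral of the
derivative along the line. -/
theorem exists_seq_ae_tendsto_zero_of_boundary {m : ℕ} {Ω : Set (Euc (m + 1))} (hΩ : IsOpen Ω)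
    (hb : Bornology.IsBounded Ω) {s : ℕ → Euc (m + 1) → ℝ} (hs : ∀ k, ContDiff ℝ 1 (s k))
    (hgrad : Tendsto (fun k => eLpNorm (partialDeriv 0 (s k)) 2 (volume.restrict Ω)) atTop (𝓝 0))
    (hbd : Tendsto (fun k => eLpNorm (s k) 2 (surfaceMeasure Ω)) atTop (𝓝 0)) :
    ∃ ns : ℕ → ℕ, StrictMono ns ∧
      ∀ᵐ x ∂(volume.restrict Ω), Tendsto (fun k => s (ns k) x) atTop (𝓝 0) := by
  have hfin : volume Ω ≠ ⊤ := hb.measure_lt_top.ne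
  -- `Ω` has finite measure, so convergence in `L²` implies convergence in `L¹`.
  have hL1 : Tendsto (fun k => ∫⁻ x in Ω, ‖partialDeriv 0 (s k) x‖ₑ) atTop (𝓝 0) := by
    have hC : (volume.restrict Ω) Set.univ ^ (1 / (1 : ENNReal).toReal - 1 / (2 : ENNReal).toReal)
        ≠ ⊤ := by
      rw [Measure.restrict_apply_univ]
      exact ENNReal.rpow_ne_top_of_nonneg (by norm_num) hfin
    have := ENNReal.Tendsto.mul_const hgrad (Or.inr hC)
    rw [zero_mul] at this
    refine tendsto_of_tendsto_of_tendsto_of_le_of_le tendsto_const_nhds this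
      (fun k => zero_le) (fun k => ?_)
    have h1 := eLpNorm_le_eLpNorm_mul_rpow_measure_univ (p := 1) (q := 2)
      (μ := volume.restrict Ω) (by norm_num)
      (continuous_partialDeriv (hs k) 0).aestronglyMeasurable
    rwa [eLpNorm_one_eq_lintegral_enorm] at h1
  set line : (Fin m → ℝ) → Set ℝ := fun y => {t | (splitCoord m).symm (y, t) ∈ Ω} with hline
  have hcont : ∀ k, Continuous (partialDeriv 0 (s k)) := fun k => continuous_partialDeriv (hs k) 0
  have hline_open : ∀ y, IsOpen (line y) := fun y =>
    hΩ.preimage (continuous_splitCoord_symm_line y)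
  have hmeas : ∀ k, Measurable fun x => Ω.indicator (fun x => ‖partialDeriv 0 (s k) x‖ₑ) x :=
    fun k => (hcont k).measurable.enorm.indicator hΩ.measurableSet
  have hslice : ∀ k y, ∫⁻ t in line y, ‖partialDeriv 0 (s k) ((splitCoord m).symm (y, t))‖ₑ =
      ∫⁻ t, Ω.indicator (fun x => ‖partialDeriv 0 (s k) x‖ₑ) ((splitCoord m).symm (y, t)) := by
    intro k y
    rw [← lintegral_indicator (hline_open y).measurableSet]
    rfl
  -- Fubini: a subsequence of the derivatives tends to zero in `L¹` along almost every line.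
  have hfub : ∀ k, ∫⁻ x in Ω, ‖partialDeriv 0 (s k) x‖ₑ =
      ∫⁻ y, ∫⁻ t in line y, ‖partialDeriv 0 (s k) ((splitCoord m).symm (y, t))‖ₑ := by
    intro k
    simp_rw [hslice]
    rw [← lintegral_indicator hΩ.measurableSet,
      ← ((measurePreserving_splitCoord m).symm (splitCoord m)).lintegral_comp (hmeas k)]
    exact lintegral_prod _ ((hmeas k).comp (splitCoord m).symm.measurable).aemeasurable
  simp_rw [hfub] at hL1
  obtain ⟨n1, hn1, h1⟩ := exists_seq_ae_tendsto_zero_of_lintegral (fun k => by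
    simp_rw [hslice]
    exact (((hmeas k).comp (splitCoord m).symm.measurable).lintegral_prod_right').aemeasurable) hL1
  obtain ⟨n2, hn2, h2⟩ := exists_seq_ae_tendsto_of_eLpNorm (f := fun k => s (n1 k))
    (g := fun _ => (0 : ℝ)) (fun k => (hs _).continuous.aestronglyMeasurable)
    aestronglyMeasurable_const (by simp only [sub_zero]; exact hbd.comp hn1.tendsto_atTop)
  refine ⟨n1 ∘ n2, hn1.comp hn2, ?_⟩
  rw [ae_restrict_iff' hΩ.measurableSet]
  have key : ∀ᵐ y : Fin m → ℝ, ∀ t, (splitCoord m).symm (y, t) ∈ Ω →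
      Tendsto (fun k => s (n1 (n2 k)) ((splitCoord m).symm (y, t))) atTop (𝓝 0) := by
    filter_upwards [h1, ae_line_of_ae_surfaceMeasure h2] with y hy1 hy2 t ht
    have hbdd : BddBelow (line y) := by
      obtain ⟨R, hR⟩ := hb.exists_norm_le
      refine ⟨-R, fun r hr => ?_⟩
      have h3 := (PiLp.norm_apply_le ((splitCoord m).symm (y, r)) 0).trans (hR _ hr)
      have h4 : (splitCoord m).symm (y, r) 0 = r :=
        congrArg Prod.snd ((splitCoord m).apply_symm_apply (y, r))
      rw [h4] at h3
      exact (abs_le.mp h3).1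
    -- The exit point depends only on the line and `t`, not on `k`.
    obtain ⟨a, hat, haf, haS⟩ := exists_left_exit (hline_open y) hbdd (show t ∈ line y from ht)
    have haΩ : (splitCoord m).symm (y, a) ∈ frontier Ω :=
      (continuous_splitCoord_symm_line y).frontier_preimage_subset Ω haf
    have hle : ∀ k, ‖s (n1 (n2 k)) ((splitCoord m).symm (y, t))‖ₑ ≤
        ‖s (n1 (n2 k)) ((splitCoord m).symm (y, a))‖ₑ +
        ∫⁻ r in line y, ‖partialDeriv 0 (s (n1 (n2 k))) ((splitCoord m).symm (y, r))‖ₑ := fun k =>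
      enorm_le_enorm_add_lintegral_deriv (hasDerivAt_comp_splitCoord_symm (hs _) y)
        ((hcont _).comp (continuous_splitCoord_symm_line y)) hat haS
    have hlim := ((hy2 a haΩ).enorm).add (hy1.comp hn2.tendsto_atTop)
    rw [enorm_zero, add_zero] at hlim
    rw [tendsto_zero_iff_enorm_tendsto_zero]
    exact tendsto_of_tendsto_of_tendsto_of_le_of_le tendsto_const_nhds hlim
      (fun k => zero_le) hle
  have key2 : ∀ᵐ z : (Fin m → ℝ) × ℝ, (splitCoord m).symm z ∈ Ω →
      Tendsto (fun k => s (n1 (n2 k)) ((splitCoord m).symm z)) atTop (𝓝 0) := by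
    have := (Measure.quasiMeasurePreserving_fst (μ := (volume : Measure (Fin m → ℝ)))
      (ν := (volume : Measure ℝ))).ae key
    filter_upwards [this] with z hz using hz z.2
  filter_upwards [(measurePreserving_splitCoord m).quasiMeasurePreserving.ae key2] with x hx
  simpa using hx

/-! ### A smooth substitute for the positive part -/

/-- A smooth nondecreasing function that vanishes exactly on `(-∞, 0]` and is `1`-Lipschitz: the
primitive of `Real.smoothTransition`. Composition with it plays the role of the positive part. -/
noncomputable def smoothPosPart (t : ℝ) : ℝ := ∫ r in (0 : ℝ)..t, Real.smoothTransition r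

theorem hasDerivAt_smoothPosPart (t : ℝ) :
    HasDerivAt smoothPosPart (Real.smoothTransition t) t :=
  (Real.smoothTransition.continuous.integral_hasStrictDerivAt 0 t).hasDerivAt

theorem contDiff_smoothPosPart : ContDiff ℝ ∞ smoothPosPart := by
  rw [contDiff_infty_iff_deriv]
  refine ⟨fun t => (hasDerivAt_smoothPosPart t).differentiableAt, ?_⟩
  rw [funext fun t => (hasDerivAt_smoothPosPart t).deriv]
  exact Real.smoothTransition.contDiff

theorem abs_smoothPosPart_sub_le (r t : ℝ) :
    |smoothPosPart r - smoothPosPart t| ≤ |r - t| := by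
  have h : LipschitzWith 1 smoothPosPart := by
    refine lipschitzWith_of_nnnorm_deriv_le
      (fun t => (hasDerivAt_smoothPosPart t).differentiableAt) fun t => ?_
    rw [(hasDerivAt_smoothPosPart t).deriv, ← NNReal.coe_le_coe, coe_nnnorm, Real.norm_eq_abs,
      abs_of_nonneg (Real.smoothTransition.nonneg t)]
    exact Real.smoothTransition.le_one t
  simpa [Real.dist_eq] using h.dist_le_mul r t

theorem smoothPosPart_of_nonpos {t : ℝ} (ht : t ≤ 0) : smoothPosPart t = 0 := by
  rw [smoothPosPart, intervalIntegral.integral_symm, neg_eq_zero]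
  refine (intervalIntegral.integral_congr fun r hr => ?_).trans intervalIntegral.integral_zero
  rw [Set.uIcc_of_le ht] at hr
  exact Real.smoothTransition.zero_of_nonpos hr.2

theorem smoothPosPart_pos {t : ℝ} (ht : 0 < t) : 0 < smoothPosPart t :=
  intervalIntegral.intervalIntegral_pos_of_pos_on
    (Real.smoothTransition.continuous.intervalIntegrable _ _)
    (fun _ hr => Real.smoothTransition.pos_of_pos hr.1) ht

/-! ### Convergence in `L²` -/

section
variable {α : Type*} [MeasurableSpace α] {μ : Measure α}

theorem tendsto_eLpNorm_zero_of_le_mul {E F : Type*} [NormedAddCommGroup E] [NormedAddCommGroup F]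
    {f : ℕ → α → E} {g : ℕ → α → F} (C : ℝ) (hle : ∀ k, ∀ᵐ x ∂μ, ‖f k x‖ ≤ C * ‖g k x‖)
    (hg : Tendsto (fun k => eLpNorm (g k) 2 μ) atTop (𝓝 0)) :
    Tendsto (fun k => eLpNorm (f k) 2 μ) atTop (𝓝 0) := by
  have h := ENNReal.Tendsto.const_mul (a := ENNReal.ofReal C) hg (Or.inr ENNReal.ofReal_ne_top)
  rw [mul_zero] at h
  exact tendsto_of_tendsto_of_tendsto_of_le_of_le tendsto_const_nhds h (fun _ => zero_le)
    fun k => eLpNorm_le_mul_eLpNorm_of_ae_le_mul (hle k) 2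

theorem tendsto_eLpNorm_add_zero {f g : ℕ → α → ℝ} (hfm : ∀ k, AEStronglyMeasurable (f k) μ)
    (hgm : ∀ k, AEStronglyMeasurable (g k) μ)
    (hf : Tendsto (fun k => eLpNorm (f k) 2 μ) atTop (𝓝 0))
    (hg : Tendsto (fun k => eLpNorm (g k) 2 μ) atTop (𝓝 0)) :
    Tendsto (fun k => eLpNorm (f k + g k) 2 μ) atTop (𝓝 0) := by
  have h := hf.add hg
  rw [add_zero] at h
  exact tendsto_of_tendsto_of_tendsto_of_le_of_le tendsto_const_nhds h (fun _ => zero_le)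
    fun k => eLpNorm_add_le (hfm k) (hgm k) (by norm_num)

theorem tendsto_eLpNorm_sum_zero {ι : Type*} (S : Finset ι) {f : ι → ℕ → α → ℝ}
    (hfm : ∀ j k, AEStronglyMeasurable (f j k) μ)
    (hf : ∀ j, Tendsto (fun k => eLpNorm (f j k) 2 μ) atTop (𝓝 0)) :
    Tendsto (fun k => eLpNorm (∑ j ∈ S, f j k) 2 μ) atTop (𝓝 0) := by
  have h := tendsto_finsetSum S fun j _ => hf j
  rw [Finset.sum_const_zero] at h
  exact tendsto_of_tendsto_of_tendsto_of_le_of_le tendsto_const_nhds h (fun _ => zero_le)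
    fun k => eLpNorm_sum_le (fun j _ => hfm j k) (by norm_num)

theorem tendsto_eLpNorm_mul_zero_of_ae {w : ℕ → α → ℝ} {A : α → ℝ} (C : ℝ)
    (hw : ∀ k, AEStronglyMeasurable (w k) μ) (hA : MemLp A 2 μ) (hle : ∀ k x, |w k x| ≤ C)
    (hlim : ∀ᵐ x ∂μ, Tendsto (fun k => w k x) atTop (𝓝 0)) :
    Tendsto (fun k => eLpNorm (fun x => w k x * A x) 2 μ) atTop (𝓝 0) := by
  simp_rw [eLpNorm_eq_lintegral_rpow_enorm_toReal (p := 2) (by norm_num) (by norm_num)]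
  have hCA : MemLp (fun x => C * A x) 2 μ := hA.const_mul C
  have hfin : ∫⁻ x, ‖C * A x‖ₑ ^ (2 : ENNReal).toReal ∂μ ≠ ⊤ :=
    (lintegral_rpow_enorm_lt_top_of_eLpNorm_lt_top (by norm_num) (by norm_num) hCA.2).ne
  have h := tendsto_lintegral_of_dominated_convergence' (μ := μ)
    (F := fun k x => ‖w k x * A x‖ₑ ^ (2 : ENNReal).toReal) (f := fun _ => 0)
    (fun x => ‖C * A x‖ₑ ^ (2 : ENNReal).toReal)
    (fun k => ((hw k).mul hA.1).enorm.pow_const _)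
    (fun k => Eventually.of_forall fun x => by
      simp only [enorm_mul]
      gcongr
      rw [Real.enorm_eq_ofReal_abs, Real.enorm_eq_ofReal_abs]
      exact ENNReal.ofReal_le_ofReal ((hle k x).trans (le_abs_self C))) hfin
    (by
      filter_upwards [hlim] with x hx
      have h1 := ((hx.mul_const (A x)).enorm).ennrpow_const (2 : ENNReal).toReal
      simpa using h1)
  rw [lintegral_zero] at h
  have h2 := h.ennrpow_const (1 / (2 : ENNReal).toReal)
  simpa using h2

/-- Products of factors bounded by one, converging almost everywhere, with a sequence converging in
`L²` converge in `L²`. -/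
theorem tendsto_eLpNorm_mul_sub_mul {w : ℕ → α → ℝ} {w' : α → ℝ} {A : ℕ → α → ℝ} {A' : α → ℝ}
    (hwm : ∀ k, AEStronglyMeasurable (w k) μ) (hwm' : AEStronglyMeasurable w' μ)
    (hAm : ∀ k, AEStronglyMeasurable (A k) μ) (hA' : MemLp A' 2 μ)
    (hw : ∀ k x, |w k x| ≤ 1) (hw' : ∀ x, |w' x| ≤ 1)
    (hlim : ∀ᵐ x ∂μ, Tendsto (fun k => w k x) atTop (𝓝 (w' x)))
    (hA : Tendsto (fun k => eLpNorm (fun x => A k x - A' x) 2 μ) atTop (𝓝 0)) :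
    Tendsto (fun k => eLpNorm (fun x => w k x * A k x - w' x * A' x) 2 μ) atTop (𝓝 0) := by
  -- `w A - w' A' = w (A - A') + (w - w') A'`, the last term being handled by domination.
  have h1 : Tendsto (fun k => eLpNorm (fun x => w k x * (A k x - A' x)) 2 μ) atTop (𝓝 0) := by
    refine tendsto_eLpNorm_zero_of_le_mul 1 (fun k => Eventually.of_forall fun x => ?_) hA
    rw [norm_mul]
    exact mul_le_mul_of_nonneg_right (hw k x) (norm_nonneg _)
  have h2 : Tendsto (fun k => eLpNorm (fun x => (w k x - w' x) * A' x) 2 μ) atTop (𝓝 0) := by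
    refine tendsto_eLpNorm_mul_zero_of_ae 2 (fun k => (hwm k).sub hwm') hA'
      (fun k x => (abs_sub _ _).trans (by linarith [hw k x, hw' x])) ?_
    filter_upwards [hlim] with x hx
    simpa using hx.sub_const (w' x)
  refine (tendsto_eLpNorm_add_zero (fun k => (hwm k).mul ((hAm k).sub hA'.1))
    (fun k => ((hwm k).sub hwm').mul hA'.1) h1 h2).congr fun k => ?_
  congr 1
  ext x
  simp only [Pi.add_apply, Pi.mul_apply, Pi.sub_apply]
  ring

theorem tendsto_integral_mul_of_eLpNorm {F : ℕ → α → ℝ} {f h : α → ℝ}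
    (hF : ∀ k, MemLp (F k) 2 μ) (hf : MemLp f 2 μ) (hh : MemLp h 2 μ)
    (hlim : Tendsto (fun k => eLpNorm (fun x => F k x - f x) 2 μ) atTop (𝓝 0)) :
    Tendsto (fun k => ∫ x, F k x * h x ∂μ) atTop (𝓝 (∫ x, f x * h x ∂μ)) := by
  refine tendsto_integral_of_L1' _ (hf.1.mul hh.1)
    (Eventually.of_forall fun k => (hF k).integrable_mul hh) ?_
  have h0 := ENNReal.Tendsto.mul_const (b := eLpNorm h 2 μ) hlim (Or.inr hh.2.ne)
  rw [zero_mul] at h0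
  refine tendsto_of_tendsto_of_tendsto_of_le_of_le tendsto_const_nhds h0 (fun _ => zero_le)
    fun k => ?_
  refine (le_of_eq ?_).trans 
    (eLpNorm_smul_le_mul_eLpNorm (p := 2) (q := 2) (r := 1) hh.1 ((hF k).1.sub hf.1))
  congr 1
  ext x
  simp [sub_mul]

end

/-! ### Weak gradients -/

theorem Continuous.memLp_restrict_of_isBounded {n : ℕ} {F : Type*} [NormedAddCommGroup F]
    {f : Euc n → F} (hf : Continuous f) {Ω : Set (Euc n)} (hΩ : IsOpen Ω)
    (hb : Bornology.IsBounded Ω) (p : ENNReal) : MemLp f p (volume.restrict Ω) := by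
  have : IsFiniteMeasure (volume.restrict Ω) :=
    ⟨by rw [Measure.restrict_apply_univ]; exact hb.measure_lt_top⟩
  obtain ⟨C, hC⟩ := hb.isCompact_closure.exists_bound_of_continuousOn hf.continuousOn
  refine MemLp.of_bound hf.aestronglyMeasurable C ?_
  rw [ae_restrict_iff' hΩ.measurableSet]
  exact Eventually.of_forall fun x hx => hC x (subset_closure hx)

theorem partialDeriv_apply {n N : ℕ} {φ : Euc n → Euc N} (hφ : ContDiff ℝ ∞ φ) (i : Fin n)
    (x : Euc n) (α : Fin N) :
    partialDeriv i (fun x => φ x α) x = partialDeriv i φ x α := by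
  have h1 : HasFDerivAt φ (fderiv ℝ φ x) x :=
    (hφ.differentiable (by simp) x).hasFDerivAt
  have h2 := ((EuclideanSpace.proj α : Euc N →L[ℝ] ℝ).hasFDerivAt (x := φ x)).comp x h1
  have h3 : HasFDerivAt (fun x => φ x α)
      ((EuclideanSpace.proj α : Euc N →L[ℝ] ℝ).comp (fderiv ℝ φ x)) x := h2
  rw [partialDeriv, h3.fderiv]
  rfl

theorem setIntegral_mul_partialDeriv {n : ℕ} {Ω : Set (Euc n)} {f φ : Euc n → ℝ}
    (hf : ContDiff ℝ ∞ f) (hφ : ContDiff ℝ ∞ φ) (hc : HasCompactSupport φ)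
    (hsupp : tsupport φ ⊆ Ω) (i : Fin n) :
    ∫ x in Ω, f x * partialDeriv i φ x = -∫ x in Ω, partialDeriv i f x * φ x := by
  have hdφ : ∀ x, x ∉ tsupport φ → partialDeriv i φ x = 0 := by
    intro x hx
    have : fderiv ℝ φ x = 0 := by
      by_contra h
      exact hx (support_fderiv_subset ℝ h)
    simp [partialDeriv, this]
  have hcd : HasCompactSupport (partialDeriv i φ) :=
    HasCompactSupport.intro hc.isCompact hdφ
  have hφc := hφ.continuous
  have hfc := hf.continuous
  have hdf := continuous_partialDeriv (hf.of_le (by simp)) i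
  have hdφc := continuous_partialDeriv (hφ.of_le (by simp)) i
  rw [setIntegral_eq_integral_of_forall_compl_eq_zero, setIntegral_eq_integral_of_forall_compl_eq_zero]
  · exact integral_mul_fderiv_eq_neg_fderiv_mul_of_integrable
      ((hdf.mul hφc).integrable_of_hasCompactSupport hc.mul_left)
      ((hfc.mul hdφc).integrable_of_hasCompactSupport hcd.mul_left)
      ((hfc.mul hφc).integrable_of_hasCompactSupport hc.mul_left)
      (fun x _ => hf.differentiable (by simp) x) (fun x _ => hφ.differentiable (by simp) x)
  · intro x hx
    rw [image_eq_zero_of_notMem_tsupport fun h => hx (hsupp h), mul_zero]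
  · intro x hx
    rw [hdφ x fun h => hx (hsupp h), mul_zero]

/-- Limits of smooth functions in `W^{1,2}(Ω)` satisfy the integration by parts formula. -/
theorem hasSobolevGradient_of_tendsto {n N : ℕ} {Ω : Set (Euc n)} (hΩ : IsOpen Ω)
    (hb : Bornology.IsBounded Ω) {u : Euc n → Euc N} {G : Euc n → Matrix (Fin N) (Fin n) ℝ}
    (hu : MemLp u 2 (volume.restrict Ω))
    (hG : ∀ α i, MemLp (fun x => G x α i) 2 (volume.restrict Ω))
    {φ : ℕ → Euc n → Euc N} (hφ : ∀ k, ContDiff ℝ ∞ (φ k))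
    (hlim : Tendsto (fun k => eLpNorm (fun x => φ k x - u x) 2 (volume.restrict Ω)) atTop (𝓝 0))
    (hlimG : ∀ α i, Tendsto
      (fun k => eLpNorm (fun x => partialDeriv i (φ k) x α - G x α i) 2 (volume.restrict Ω))
      atTop (𝓝 0)) :
    HasSobolevGradient Ω u G := by
  refine ⟨hu, hG, fun θ hθ hc hsupp α i => ?_⟩
  have hθ1 : ContDiff ℝ 1 θ := hθ.of_le (by simp)
  have huα : MemLp (fun x => u x α) 2 (volume.restrict Ω) :=
    hu.of_le ((EuclideanSpace.proj α : Euc N →L[ℝ] ℝ).continuous.comp_aestronglyMeasurable hu.1)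
      (Eventually.of_forall fun x => PiLp.norm_apply_le (u x) α)
  have hφα : ∀ k, ContDiff ℝ ∞ fun x => φ k x α := fun k =>
    (EuclideanSpace.proj α : Euc N →L[ℝ] ℝ).contDiff.comp (hφ k)
  have h1 := tendsto_integral_mul_of_eLpNorm (μ := volume.restrict Ω)
    (F := fun k x => φ k x α) (f := fun x => u x α) (h := partialDeriv i θ)
    (fun k => (hφα k).continuous.memLp_restrict_of_isBounded hΩ hb 2) huα
    ((continuous_partialDeriv hθ1 i).memLp_restrict_of_isBounded hΩ hb 2)
    (tendsto_eLpNorm_zero_of_le_mul 1 (fun k => Eventually.of_forall fun x => by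
      simpa using PiLp.norm_apply_le (φ k x - u x) α) hlim)
  have h2 := tendsto_integral_mul_of_eLpNorm (μ := volume.restrict Ω)
    (F := fun k x => partialDeriv i (φ k) x α) (f := fun x => G x α i) (h := θ)
    (fun k => by
      simp_rw [← partialDeriv_apply (hφ k)]
      exact (continuous_partialDeriv ((hφα k).of_le (by simp)) i).memLp_restrict_of_isBounded
        hΩ hb 2) (hG α i)
    (hθ.continuous.memLp_restrict_of_isBounded hΩ hb 2) (hlimG α i)
  refine tendsto_nhds_unique h1 (h2.neg.congr fun k => ?_)
  rw [setIntegral_mul_partialDeriv (hφα k) hθ hc hsupp i]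
  simp_rw [partialDeriv_apply (hφ k)]

theorem HasSobolevGradient.ae_eq {n N : ℕ} {Ω : Set (Euc n)} (hΩ : IsOpen Ω)
    {u : Euc n → Euc N} {G₁ G₂ : Euc n → Matrix (Fin N) (Fin n) ℝ}
    (h₁ : HasSobolevGradient Ω u G₁) (h₂ : HasSobolevGradient Ω u G₂) :
    ∀ᵐ x ∂(volume.restrict Ω), G₁ x = G₂ x := by
  have key : ∀ α i, ∀ᵐ x ∂(volume.restrict Ω), G₁ x α i - G₂ x α i = 0 := by
    intro α i
    rw [ae_restrict_iff' hΩ.measurableSet]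
    refine hΩ.ae_eq_zero_of_integral_contDiff_smul_eq_zero ?_ fun θ hθ hc hsupp => ?_
    · have hL2 : MemLp (fun x => G₁ x α i - G₂ x α i) 2 (volume.restrict Ω) :=
        (h₁.memLp_grad α i).sub (h₂.memLp_grad α i)
      rw [locallyIntegrableOn_iff hΩ.isLocallyClosed]
      intro K hK hKc
      have : IsFiniteMeasure (volume.restrict K) :=
        ⟨by rw [Measure.restrict_apply_univ]; exact hKc.measure_lt_top⟩
      exact (hL2.mono_measure (Measure.restrict_mono hK le_rfl)).integrable (by norm_num)
    · have hθL : MemLp θ 2 (volume.restrict Ω) :=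
        (hθ.continuous.memLp_of_hasCompactSupport hc).restrict Ω
      have e : ∫ x in Ω, G₁ x α i * θ x = ∫ x in Ω, G₂ x α i * θ x := by
        have a₁ := h₁.integral_by_parts θ hθ hc hsupp α i
        have a₂ := h₂.integral_by_parts θ hθ hc hsupp α i
        linarith
      rw [← setIntegral_eq_integral_of_forall_compl_eq_zero (s := Ω)]
      · have : ∀ x, θ x • (G₁ x α i - G₂ x α i) = G₁ x α i * θ x - G₂ x α i * θ x := by
          intro x; simp only [smul_eq_mul]; ring
        simp_rw [this]
        have i₁ : Integrable (fun x => G₁ x α i * θ x) (volume.restrict Ω) :=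
          (h₁.memLp_grad α i).integrable_mul hθL
        have i₂ : Integrable (fun x => G₂ x α i * θ x) (volume.restrict Ω) :=
          (h₂.memLp_grad α i).integrable_mul hθL
        exact (integral_sub i₁ i₂).trans (sub_eq_zero.mpr e)
      · intro x hx
        rw [image_eq_zero_of_notMem_tsupport fun h => hx (hsupp h), zero_smul]
  have h := ae_all_iff.mpr fun α => ae_all_iff.mpr fun i => key α i
  filter_upwards [h] with x hx
  ext α i
  exact sub_eq_zero.mp (hx α i)

/-! ### Truncation -/

theorem partialDeriv_smoothPosPart_comp {n N : ℕ} {φ : Euc n → Euc N} (hφ : ContDiff ℝ ∞ φ)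
    (ν : Euc N) (c : ℝ) (i : Fin n) (x : Euc n) :
    partialDeriv i (fun x => smoothPosPart (inner ℝ ν (φ x) - c)) x =
      Real.smoothTransition (inner ℝ ν (φ x) - c) * ∑ β, ν β * partialDeriv i φ x β := by
  have h1 : HasFDerivAt φ (fderiv ℝ φ x) x := (hφ.differentiable (by simp) x).hasFDerivAt
  have h2 : HasFDerivAt (fun x => inner ℝ ν (φ x) - c) ((innerSL ℝ ν).comp (fderiv ℝ φ x)) x :=
    (((innerSL ℝ ν).hasFDerivAt (x := φ x)).comp x h1).sub_const c
  have h3 : HasFDerivAt (fun x => smoothPosPart (inner ℝ ν (φ x) - c))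
      (Real.smoothTransition (inner ℝ ν (φ x) - c) • (innerSL ℝ ν).comp (fderiv ℝ φ x)) x :=
    HasDerivAt.comp_hasFDerivAt (h₂ := smoothPosPart) x (hasDerivAt_smoothPosPart _) h2
  rw [partialDeriv, h3.fderiv]
  simp [partialDeriv, PiLp.inner_apply, mul_comm]

/-- If the trace of `u` lies in the half-space `⟪ν, ·⟫ ≤ c`, then the truncation of `⟪ν, u⟫ - c` is
a limit in `W^{1,2}(Ω)` of smooth functions whose boundary values tend to zero in `L²(∂Ω)`. -/
theorem HasTrace.exists_seq_smoothPosPart {n N : ℕ} {Ω : Set (Euc n)} {u g : Euc n → Euc N}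
    (hg : HasTrace Ω u g) {ν : Euc N} {c : ℝ}
    (hc : ∀ᵐ x ∂(surfaceMeasure Ω), inner ℝ ν (g x) ≤ c) :
    ∃ G : Euc n → Matrix (Fin N) (Fin n) ℝ, HasSobolevGradient Ω u G ∧
    ∃ s : ℕ → Euc n → ℝ, (∀ k, ContDiff ℝ ∞ (s k)) ∧
      (∀ᵐ x ∂(volume.restrict Ω),
        Tendsto (fun k => s k x) atTop (𝓝 (smoothPosPart (inner ℝ ν (u x) - c)))) ∧
      Tendsto (fun k => eLpNorm (fun x => s k x - smoothPosPart (inner ℝ ν (u x) - c)) 2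
        (volume.restrict Ω)) atTop (𝓝 0) ∧
      (∀ i, Tendsto (fun k => eLpNorm (fun x => partialDeriv i (s k) x -
        Real.smoothTransition (inner ℝ ν (u x) - c) * ∑ β, ν β * G x β i) 2
          (volume.restrict Ω)) atTop (𝓝 0)) ∧
      Tendsto (fun k => eLpNorm (s k) 2 (surfaceMeasure Ω)) atTop (𝓝 0) := by
  obtain ⟨-, G, hG, φ, hφ, hlim, hlimG, hlimg⟩ := hg
  obtain ⟨ns, hns, hae⟩ := exists_seq_ae_tendsto_of_eLpNorm
    (fun k => (hφ k).continuous.aestronglyMeasurable) hG.memLp.1 hlim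
  have hcont : Continuous fun y : Euc N => inner ℝ ν y - c := by fun_prop
  have hle : ∀ y z : Euc N, ‖smoothPosPart (inner ℝ ν y - c) - smoothPosPart (inner ℝ ν z - c)‖ ≤
      ‖ν‖ * ‖y - z‖ := by
    intro y z
    refine (abs_smoothPosPart_sub_le _ _).trans ?_
    rw [sub_sub_sub_cancel_right, ← inner_sub_right]
    exact abs_real_inner_le_norm ν (y - z)
  refine ⟨G, hG, fun k x => smoothPosPart (inner ℝ ν (φ (ns k) x) - c),
    fun k => contDiff_smoothPosPart.comp ((contDiff_const.inner ℝ (hφ _)).sub contDiff_const),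
    ?_, ?_, fun i => ?_, ?_⟩
  · filter_upwards [hae] with x hx
    exact (contDiff_smoothPosPart.continuous.tendsto _).comp ((hcont.tendsto _).comp hx)
  · exact tendsto_eLpNorm_zero_of_le_mul ‖ν‖ (fun k => Eventually.of_forall fun x => hle _ _)
      (hlim.comp hns.tendsto_atTop)
  · simp_rw [partialDeriv_smoothPosPart_comp (hφ _)]
    have hdm : ∀ k β, AEStronglyMeasurable (fun x => partialDeriv i (φ k) x β)
        (volume.restrict Ω) := fun k β =>
      ((EuclideanSpace.proj β : Euc N →L[ℝ] ℝ).continuous.comp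
        (continuous_partialDeriv ((hφ k).of_le (by simp)) i)).aestronglyMeasurable
    have habs : ∀ t, |Real.smoothTransition t| ≤ 1 := fun t => by
      rw [abs_of_nonneg (Real.smoothTransition.nonneg t)]
      exact Real.smoothTransition.le_one t
    have hcomp := Real.smoothTransition.continuous.comp hcont
    refine tendsto_eLpNorm_mul_sub_mul
      (fun k => (hcomp.comp (hφ _).continuous).aestronglyMeasurable)
      (hcomp.comp_aestronglyMeasurable hG.memLp.1)
      (fun k => Finset.aestronglyMeasurable_fun_sum _ fun β _ => (hdm _ β).const_mul _)
      (memLp_finsetSum _ fun β _ => (hG.memLp_grad β i).const_mul _)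
      (fun _ _ => habs _) (fun _ => habs _) ?_ ?_
    · filter_upwards [hae] with x hx
      exact (hcomp.tendsto _).comp hx
    · have h := tendsto_eLpNorm_sum_zero (μ := volume.restrict Ω) Finset.univ
        (f := fun β k x => ν β * (partialDeriv i (φ (ns k)) x β - G x β i))
        (fun β k => ((hdm _ β).sub (hG.memLp_grad β i).1).const_mul _)
        (fun β => tendsto_eLpNorm_zero_of_le_mul ‖ν β‖
          (fun k => Eventually.of_forall fun x => (norm_mul _ _).le)
          ((hlimG β i).comp hns.tendsto_atTop))
      refine h.congr fun k => ?_
      congr 1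
      ext x
      simp only [Finset.sum_apply, mul_sub, Finset.sum_sub_distrib]
  -- On `∂Ω` the truncation of the trace vanishes, so the Lipschitz bound controls the truncation of
  -- `φₖ` by the distance of `φₖ` to the trace.
  · refine tendsto_eLpNorm_zero_of_le_mul ‖ν‖ (fun k => ?_) (hlimg.comp hns.tendsto_atTop)
    filter_upwards [hc] with x hx
    have h := hle (φ (ns k) x) (g x)
    rwa [smoothPosPart_of_nonpos (t := inner ℝ ν (g x) - c) (by linarith), sub_zero] at h

/-! ### The maximum principle in a half-space -/

/-- The energy identity behind the maximum principle: contracted with the vector `b` solving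
`b 𝒜 = ν`, the system with coefficients `𝒜 ⊗ a` becomes a scalar equation for `⟪ν, u⟫`. -/
theorem sum_coeff_mul_eq {n N : ℕ} (𝒜 : Matrix (Fin N) (Fin N) ℝ) (a : Matrix (Fin n) (Fin n) ℝ)
    (G : Matrix (Fin N) (Fin n) ℝ) {b ν : Fin N → ℝ} (hb : Matrix.vecMul b 𝒜 = ν) (w : ℝ) :
    ∑ α, ∑ β, ∑ i, ∑ j, 𝒜 α β * a i j * G β j * (w * (∑ γ, ν γ * G γ i) * b α) =
      w * ∑ i, ∑ j, (∑ γ, ν γ * G γ i) * a i j * (∑ γ, ν γ * G γ j) := by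
  set V : Fin n → ℝ := fun i => ∑ γ, ν γ * G γ i with hV
  have hV2 : ∀ j, V j = ∑ α, ∑ β, b α * 𝒜 α β * G β j := by
    intro j
    rw [Finset.sum_comm]
    refine Finset.sum_congr rfl fun β _ => ?_
    rw [← hb, Matrix.vecMul, dotProduct, Finset.sum_mul]
  calc _ = ∑ α, ∑ i, ∑ j, ∑ β, w * (V i * a i j * (b α * 𝒜 α β * G β j)) := by
        refine Finset.sum_congr rfl fun α _ => ?_
        rw [Finset.sum_comm]
        refine Finset.sum_congr rfl fun i _ => ?_
        rw [Finset.sum_comm]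
        refine Finset.sum_congr rfl fun j _ => Finset.sum_congr rfl fun β _ => ?_
        simp only [hV]
        ring
    _ = ∑ i, ∑ j, ∑ α, ∑ β, w * (V i * a i j * (b α * 𝒜 α β * G β j)) := by
        rw [Finset.sum_comm]
        exact Finset.sum_congr rfl fun i _ => Finset.sum_comm
    _ = _ := by
        rw [Finset.mul_sum]
        refine Finset.sum_congr rfl fun i _ => ?_
        rw [Finset.mul_sum]
        refine Finset.sum_congr rfl fun j _ => ?_
        rw [show (∑ γ, ν γ * G γ j) = ∑ α, ∑ β, b α * 𝒜 α β * G β j from hV2 j]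
        simp_rw [← Finset.mul_sum]
        rfl

theorem partialDeriv_smul_const {n N : ℕ} {s : Euc n → ℝ} (hs : ContDiff ℝ ∞ s) (b : Euc N)
    (i : Fin n) (x : Euc n) : partialDeriv i (fun x => s x • b) x = partialDeriv i s x • b := by
  have h := (hs.differentiable (by simp) x).hasFDerivAt.smul_const b
  rw [partialDeriv, h.fderiv]
  rfl

/-- If the truncation of `⟪ν, u⟫ - c` is a limit in `W^{1,2}(Ω)` of smooth functions that tend to
zero in `L²(∂Ω)`, it is an admissible test function, and its gradient vanishes. -/
theorem IsWeakSolution.smoothTransition_mul_grad_eq_zero {n N : ℕ} {Ω : Set (Euc n)}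
    (hΩ : IsOpen Ω) (hbd : Bornology.IsBounded Ω)
    {𝔸 : Euc n → Fin N → Fin N → Fin n → Fin n → ℝ}
    (h𝔸 : ∀ α β i j, MemLp (fun x => 𝔸 x α β i j) ⊤ (volume.restrict Ω))
    {𝒜 : Matrix (Fin N) (Fin N) ℝ} (h𝒜 : IsUnit 𝒜.det)
    {a : Euc n → Matrix (Fin n) (Fin n) ℝ}
    (ha_ell : ∃ lam : ℝ, 0 < lam ∧ ∀ᵐ x ∂(volume.restrict Ω), ∀ ξ : Fin n → ℝ,
      lam * ∑ i, ξ i ^ 2 ≤ ∑ i, ∑ j, ξ i * a x i j * ξ j)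
    (h_split : ∀ᵐ x ∂(volume.restrict Ω), ∀ α β i j, 𝔸 x α β i j = 𝒜 α β * a x i j)
    {u : Euc n → Euc N} (hu : IsWeakSolution Ω 𝔸 u)
    {G : Euc n → Matrix (Fin N) (Fin n) ℝ} (hG : HasSobolevGradient Ω u G)
    {ν : Euc N} {c : ℝ} {s : ℕ → Euc n → ℝ} (hs : ∀ k, ContDiff ℝ ∞ (s k))
    (hlim : Tendsto (fun k => eLpNorm (fun x => s k x - smoothPosPart (inner ℝ ν (u x) - c)) 2
        (volume.restrict Ω)) atTop (𝓝 0))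
    (hlimG : ∀ i, Tendsto (fun k => eLpNorm (fun x => partialDeriv i (s k) x -
        Real.smoothTransition (inner ℝ ν (u x) - c) * ∑ β, ν β * G x β i) 2
          (volume.restrict Ω)) atTop (𝓝 0))
    (hlim0 : Tendsto (fun k => eLpNorm (s k) 2 (surfaceMeasure Ω)) atTop (𝓝 0)) :
    ∀ᵐ x ∂(volume.restrict Ω), ∀ i,
      Real.smoothTransition (inner ℝ ν (u x) - c) * ∑ β, ν β * G x β i = 0 := by
  have hfin : IsFiniteMeasure (volume.restrict Ω) :=
    ⟨by rw [Measure.restrict_apply_univ]; exact hbd.measure_lt_top⟩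
  obtain ⟨b, hb⟩ : ∃ b : Euc N, Matrix.vecMul b 𝒜 = ν :=
    ⟨WithLp.toLp 2 (Matrix.vecMul ν 𝒜⁻¹), by
      simp [Matrix.vecMul_vecMul, Matrix.nonsing_inv_mul _ h𝒜]⟩
  obtain ⟨G₀, hG₀, hweak⟩ := hu
  have hcont : Continuous fun y : Euc N => inner ℝ ν y - c := by fun_prop
  set w : Euc n → ℝ := fun x => Real.smoothTransition (inner ℝ ν (u x) - c) with hw
  have hw0 : ∀ x, 0 ≤ w x := fun x => Real.smoothTransition.nonneg _
  set H : Euc n → Matrix (Fin N) (Fin n) ℝ := fun x => .of fun α i =>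
    w x * (∑ β, ν β * G x β i) * b α with hH
  have hHL : ∀ α i, MemLp (fun x => H x α i) 2 (volume.restrict Ω) := by
    intro α i
    have h1 : MemLp (fun x => ∑ β, ν β * G x β i) 2 (volume.restrict Ω) :=
      memLp_finsetSum _ fun β _ => (hG.memLp_grad β i).const_mul _
    have hwm : AEStronglyMeasurable w (volume.restrict Ω) :=
      (Real.smoothTransition.continuous.comp hcont).comp_aestronglyMeasurable hG.memLp.1
    have h2 : MemLp (fun x => w x * ∑ β, ν β * G x β i) 2 (volume.restrict Ω) := by
      refine h1.of_le (hwm.mul h1.1) (Eventually.of_forall fun x => ?_)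
      rw [norm_mul, Real.norm_of_nonneg (hw0 x)]
      exact mul_le_of_le_one_left (norm_nonneg _) (Real.smoothTransition.le_one _)
    exact h2.mul_const (b α)
  have hvL : MemLp (fun x => smoothPosPart (inner ℝ ν (u x) - c) • b) 2 (volume.restrict Ω) := by
    have h1 : MemLp (fun x => inner ℝ ν (u x) - c) 2 (volume.restrict Ω) :=
      (hG.memLp.const_inner ν).sub (memLp_const c)
    have h2 : MemLp (fun x => smoothPosPart (inner ℝ ν (u x) - c)) 2 (volume.restrict Ω) := by
      refine h1.of_le (contDiff_smoothPosPart.continuous.comp_aestronglyMeasurable h1.1)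
        (Eventually.of_forall fun x => ?_)
      have h := abs_smoothPosPart_sub_le (inner ℝ ν (u x) - c) 0
      rwa [smoothPosPart_of_nonpos le_rfl, sub_zero, sub_zero] at h
    have h3 : MemLp (fun _ : Euc n => b) ⊤ (volume.restrict Ω) := memLp_const b
    exact h3.smul h2
  have hsb : ∀ k, ContDiff ℝ ∞ fun x => s k x • b := fun k => (hs k).smul contDiff_const
  have hlimb : Tendsto (fun k => eLpNorm (fun x => s k x • b -
      smoothPosPart (inner ℝ ν (u x) - c) • b) 2 (volume.restrict Ω)) atTop (𝓝 0) := by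
    refine tendsto_eLpNorm_zero_of_le_mul ‖b‖ (fun k => Eventually.of_forall fun x => ?_) hlim
    rw [← sub_smul, norm_smul, mul_comm]
  have hlimbG : ∀ α i, Tendsto (fun k => eLpNorm (fun x =>
      partialDeriv i (fun x => s k x • b) x α - H x α i) 2 (volume.restrict Ω)) atTop (𝓝 0) := by
    intro α i
    refine tendsto_eLpNorm_zero_of_le_mul ‖b α‖ (fun k => Eventually.of_forall fun x => ?_)
      (hlimG i)
    rw [partialDeriv_smul_const (hs k)]
    simp only [hH, Matrix.of_apply, PiLp.smul_apply, smul_eq_mul]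
    rw [← sub_mul, norm_mul, mul_comm]
  have hSob := hasSobolevGradient_of_tendsto hΩ hbd hvL hHL hsb hlimb hlimbG
  have hW0 : MemW0 Ω fun x => smoothPosPart (inner ℝ ν (u x) - c) • b := by
    refine ⟨MemLp.zero, H, hSob, fun k x => s k x • b, hsb, hlimb, hlimbG, ?_⟩
    refine tendsto_eLpNorm_zero_of_le_mul ‖b‖ (fun k => Eventually.of_forall fun x => ?_) hlim0
    rw [Pi.zero_apply, sub_zero, norm_smul, mul_comm]
  have hint := hweak _ H hW0 hSob
  obtain ⟨lam, hlam, hell⟩ := ha_ell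
  -- `G₀`, the gradient in the equation, and `G`, the one in the trace, agree almost everywhere.
  have hpt : ∀ᵐ x ∂(volume.restrict Ω),
      w x * (lam * ∑ i, (∑ γ, ν γ * G x γ i) ^ 2) ≤
        ∑ α, ∑ β, ∑ i, ∑ j, 𝔸 x α β i j * G₀ x β j * H x α i := by
    filter_upwards [hell, h_split, hG₀.ae_eq hΩ hG] with x hx1 hx2 hx3
    have h1 : ∑ α, ∑ β, ∑ i, ∑ j, 𝔸 x α β i j * G₀ x β j * H x α i =
        w x * ∑ i, ∑ j, (∑ γ, ν γ * G x γ i) * a x i j * (∑ γ, ν γ * G x γ j) := by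
      rw [← sum_coeff_mul_eq 𝒜 (a x) (G x) hb (w x)]
      simp_rw [hx2, hx3]
      rfl
    rw [h1]
    exact mul_le_mul_of_nonneg_left (hx1 _) (hw0 x)
  have hsq : ∀ x, 0 ≤ w x * (lam * ∑ i, (∑ γ, ν γ * G x γ i) ^ 2) := fun x =>
    mul_nonneg (hw0 x) (mul_nonneg hlam.le (Finset.sum_nonneg fun i _ => sq_nonneg _))
  have hIntegrable : Integrable (fun x =>
      ∑ α, ∑ β, ∑ i, ∑ j, 𝔸 x α β i j * G₀ x β j * H x α i) (volume.restrict Ω) := by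
    refine integrable_finsetSum _ fun α _ => integrable_finsetSum _ fun β _ =>
      integrable_finsetSum _ fun i _ => integrable_finsetSum _ fun j _ => ?_
    have h1 : MemLp (fun x => 𝔸 x α β i j * G₀ x β j) 2 (volume.restrict Ω) :=
      (hG₀.memLp_grad β j).mul' (h𝔸 α β i j)
    exact h1.integrable_mul (hHL α i)
  have hzero := (integral_eq_zero_iff_of_nonneg_ae
    (hpt.mono fun x hx => (hsq x).trans hx) hIntegrable).mp hint
  filter_upwards [hpt, hzero] with x hx1 hx2 i
  rw [hx2] at hx1
  have h3 : w x * (lam * ∑ i, (∑ γ, ν γ * G x γ i) ^ 2) = 0 := le_antisymm hx1 (hsq x)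
  rcases mul_eq_zero.mp h3 with h | h
  · rw [show Real.smoothTransition (inner ℝ ν (u x) - c) = 0 from h, zero_mul]
  · have h4 := (mul_eq_zero.mp h).resolve_left hlam.ne'
    rw [Finset.sum_eq_zero_iff_of_nonneg fun i _ => sq_nonneg _] at h4
    rw [pow_eq_zero_iff (by norm_num) |>.mp (h4 i (Finset.mem_univ i)), mul_zero]

/-- The maximum principle for a single half-space. -/
theorem IsWeakSolution.ae_inner_le {n N : ℕ} (hn : 1 ≤ n) {Ω : Set (Euc n)}
    (hΩ : IsOpen Ω) (hbd : Bornology.IsBounded Ω)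
    {𝔸 : Euc n → Fin N → Fin N → Fin n → Fin n → ℝ}
    (h𝔸 : ∀ α β i j, MemLp (fun x => 𝔸 x α β i j) ⊤ (volume.restrict Ω))
    {𝒜 : Matrix (Fin N) (Fin N) ℝ} (h𝒜 : IsUnit 𝒜.det)
    {a : Euc n → Matrix (Fin n) (Fin n) ℝ}
    (ha_ell : ∃ lam : ℝ, 0 < lam ∧ ∀ᵐ x ∂(volume.restrict Ω), ∀ ξ : Fin n → ℝ,
      lam * ∑ i, ξ i ^ 2 ≤ ∑ i, ∑ j, ξ i * a x i j * ξ j)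
    (h_split : ∀ᵐ x ∂(volume.restrict Ω), ∀ α β i j, 𝔸 x α β i j = 𝒜 α β * a x i j)
    {u g : Euc n → Euc N} (hu : IsWeakSolution Ω 𝔸 u) (hg : HasTrace Ω u g) {ν : Euc N} {c : ℝ}
    (hc : ∀ᵐ x ∂(surfaceMeasure Ω), inner ℝ ν (g x) ≤ c) :
    ∀ᵐ x ∂(volume.restrict Ω), inner ℝ ν (u x) ≤ c := by
  obtain ⟨m, rfl⟩ : ∃ m, n = m + 1 := ⟨n - 1, by omega⟩
  obtain ⟨G, hG, s, hs, hae, hlim, hlimG, hlim0⟩ := hg.exists_seq_smoothPosPart hc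
  have hzero := hu.smoothTransition_mul_grad_eq_zero hΩ hbd h𝔸 h𝒜 ha_ell h_split hG hs hlim
    hlimG hlim0
  have hgrad : Tendsto (fun k => eLpNorm (partialDeriv 0 (s k)) 2 (volume.restrict Ω))
      atTop (𝓝 0) := by
    refine (hlimG 0).congr fun k => eLpNorm_congr_ae ?_
    filter_upwards [hzero] with x hx
    rw [hx 0, sub_zero]
  obtain ⟨ns, hns, h0⟩ := exists_seq_ae_tendsto_zero_of_boundary hΩ hbd
    (fun k => (hs k).of_le (by simp)) hgrad hlim0
  filter_upwards [hae, h0] with x hx1 hx2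
  have h := tendsto_nhds_unique (hx1.comp hns.tendsto_atTop) hx2
  by_contra! hlt
  exact (smoothPosPart_pos (sub_pos.mpr hlt)).ne' h

/-! ### From half-spaces to the convex hull -/

theorem mainTheorem1 {n N : ℕ} (hn : 1 ≤ n) (Ω : Set (Euc n)) (hΩ : IsBoundedLipschitzDomain Ω)
    (𝔸 : Euc n → Fin N → Fin N → Fin n → Fin n → ℝ)
    (h𝔸 : ∀ α β i j, MemLp (fun x => 𝔸 x α β i j) ⊤ (volume.restrict Ω))
    (𝒜 : Matrix (Fin N) (Fin N) ℝ) (h𝒜 : 𝒜.PosDef)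
    (a : Euc n → Matrix (Fin n) (Fin n) ℝ)
    (ha : ∀ i j, MemLp (fun x => a x i j) ⊤ (volume.restrict Ω))
    (ha_symm : ∀ᵐ x ∂(volume.restrict Ω), (a x).IsSymm)
    (ha_ell : ∃ lam : ℝ, 0 < lam ∧ ∀ᵐ x ∂(volume.restrict Ω), ∀ ξ : Fin n → ℝ,
      lam * ∑ i, ξ i ^ 2 ≤ ∑ i, ∑ j, ξ i * a x i j * ξ j)
    (h_split : ∀ᵐ x ∂(volume.restrict Ω), ∀ α β i j, 𝔸 x α β i j = 𝒜 α β * a x i j)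
    (u : Euc n → Euc N) (hu : IsWeakSolution Ω 𝔸 u) :
    ∀ᵐ x ∂(volume.restrict Ω), u x ∈ boundaryHull Ω u := by
  -- The pairs `(ν, c)` whose half-space `⟪ν, ·⟫ ≤ c` contains the boundary values. Their open
  -- complements cover the complement of the hull, and countably many of them suffice.
  set I : Set (Euc N × ℝ) := {p | ∃ g, HasTrace Ω u g ∧
    ∀ᵐ x ∂(surfaceMeasure Ω), inner ℝ p.1 (g x) ≤ p.2}
  obtain ⟨T, hTI, hTc, hT⟩ := TopologicalSpace.isOpen_biUnion_countable I
    (fun p => {y : Euc N | p.2 < inner ℝ p.1 y})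
    fun p _ => isOpen_lt continuous_const (by fun_prop)
  have key : ∀ p ∈ T, ∀ᵐ x ∂(volume.restrict Ω), inner ℝ p.1 (u x) ≤ p.2 := by
    intro p hp
    obtain ⟨g, hg, hle⟩ := hTI hp
    exact hu.ae_inner_le hn hΩ.isOpen hΩ.isBounded h𝔸 h𝒜.det_pos.ne'.isUnit ha_ell h_split hg hle
  filter_upwards [(ae_ball_iff hTc).mpr key] with x hx
  rintro K ⟨hKc, hKconv, g, hg, hgK⟩
  by_contra hxK
  obtain ⟨f, c, hfc, hcx⟩ := geometric_hahn_banach_closed_point hKconv hKc hxK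
  set ν : Euc N := (InnerProductSpace.toDual ℝ (Euc N)).symm f with hν
  have hνf : ∀ y, inner ℝ ν y = f y := fun y => InnerProductSpace.toDual_symm_apply
  have hI : (ν, c) ∈ I := ⟨g, hg, by
    filter_upwards [hgK] with z hz
    rw [hνf]
    exact (hfc _ hz).le⟩
  have hmem : u x ∈ ⋃ p ∈ I, {y : Euc N | p.2 < inner ℝ p.1 y} :=
    Set.mem_biUnion hI (show c < inner ℝ ν (u x) by rwa [hνf])
  rw [← hT] at hmem
  obtain ⟨p, hp, hlt⟩ := Set.mem_iUnion₂.mp hmem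
  exact (hx p hp).not_gt hlt
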